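/- Manifolds are smooth, Hausdorff, paracompact and without boundary. Let $M$ be a manifold of dimension $4n$ with $n\ge 2$, $g$ a Riemannian metric on $M$, and $H\subset \mathrm{End}(TM)$ a field of linear subspaces. A triple $(M,g,H)$ is called *quaternion Hermitian* if $H$ is locally spanned by an *admissible basis*, that is, by smooth $g$-orthogonal almost complex structures $I_1,I_2,I_3$ with $I_\alpha I_\beta=-I_\beta I_\alpha=I_\gamma$ for every cyclic permutation $(\alpha,\beta,\gamma)$ of $(1,2,3)$. An affine connection $D$ *parallelizes* $H$ if for every local admissible basis $DI_\alpha=\sum_\beta a_{\alpha\beta}\otimes I_\beta$ with a skew-symmetric matrix $(a_{\alpha\beta})$ of $1$-forms. A quaternion Hermitian manifold (of dimension at least $8$) is *quaternion Kähler* if the Levi-Civita connection of its metric parallelizes $H$. The triple $(M,g,H)$ is *quaternion Hermitian Weyl* if $(M,g',H)$ is quaternion Hermitian for every metric $g'=e^fg$ ($f\in C^\infty(M)$) in the conformal class of $g$, and there is a smooth torsion-free connection $D$ which parallelizes $H$ and preserves the conformal class, i.e. for every such $g'$ there is a smooth $1$-form $\theta_{g'}$ with $Dg'=\theta_{g'}\otimes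 g'$. **Proposition.** Let $(M,g,H)$ be a quaternion Hermitian Weyl manifold of dimension $4n\ge 8$. Then $(M,g,H)$ is quaternion Kähler if and only if for every point $x\in M$ there is a submanifold $j:Q\to M$ (an injective immersion) with $x\in j(Q)$, of dimension $4h\ge 8$ ($h$ may depend on $x$), such that: $Q$ is totally geodesic in $(M,g)$, i.e. its second fundamental form $b(X,Y)=\nabla^g_XY-\nabla^{j^*g}_XY$ vanishes; the tangent spaces of $Q$ are invariant under $H$; and $(Q,j^*g,H_Q)$ is quaternion Kähler, where $H_Q$ consists of the restrictions to $TQ$ of the elements of $H$. -/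

import Mathlib

open Bundle Set Filter
open scoped Manifold ContDiff Topology

universe u

/-- A (smooth) Riemannian metric on a smooth `m`-dimensional manifold without boundary. -/
abbrev RiemMetric (m : ℕ) (M : Type*) [TopologicalSpace M] [ChartedSpace (EuclideanSpace ℝ (Fin m)) M]
    [IsManifold (𝓡 m) ∞ M] : Type _ :=
  ContMDiffRiemannianMetric (𝓡 m) ∞ (EuclideanSpace ℝ (Fin m))
    (fun x : M ↦ TangentSpace (𝓡 m) x)

/-- An affine connection, i.e. a covariant derivative on the tangent bundle.
`D Y x v` is the derivative `(D_v Y)(x)` of the vector field `Y` in the direction `v ∈ T_x M`. -/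
abbrev AffineConnection (m : ℕ) (M : Type*) [TopologicalSpace M]
    [ChartedSpace (EuclideanSpace ℝ (Fin m)) M] [IsManifold (𝓡 m) ∞ M] : Type _ :=
  CovariantDerivative (𝓡 m) (EuclideanSpace ℝ (Fin m)) (fun x : M ↦ TangentSpace (𝓡 m) x)

section Definitions

variable {m : ℕ} {M : Type*} [TopologicalSpace M] [ChartedSpace (EuclideanSpace ℝ (Fin m)) M]
  [IsManifold (𝓡 m) ∞ M]

/-- The vector field `Y` is differentiable at `x`. The tensorial conditions below are imposed for
all vector fields differentiable at the given point; since they are tensorial, this is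
the same as imposing them for smooth vector fields only. -/
def DiffFieldAt (Y : Π x : M, TangentSpace (𝓡 m) x) (x : M) : Prop :=
  MDifferentiableAt (𝓡 m) ((𝓡 m).prod 𝓘(ℝ, EuclideanSpace ℝ (Fin m)))
    (fun y ↦ TotalSpace.mk' (EuclideanSpace ℝ (Fin m)) (E := fun x : M ↦ TangentSpace (𝓡 m) x)
      y (Y y)) x

/-- The `1`-form `θ` is smooth, as a section of the cotangent bundle. -/
def SmoothOneForm (θ : Π x : M, TangentSpace (𝓡 m) x →L[ℝ] ℝ) : Prop :=
  ContMDiff (𝓡 m) ((𝓡 m).prod 𝓘(ℝ, EuclideanSpace ℝ (Fin m) →L[ℝ] ℝ)) ∞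
    (fun x ↦ TotalSpace.mk' (EuclideanSpace ℝ (Fin m) →L[ℝ] ℝ)
      (E := fun x : M ↦ TangentSpace (𝓡 m) x →L[ℝ] Bundle.Trivial M ℝ x) x (θ x))

/-- The field of endomorphisms `J` is smooth on `U`, as a section of `End(TM)`. -/
def SmoothEndOn (J : Π x : M, TangentSpace (𝓡 m) x →L[ℝ] TangentSpace (𝓡 m) x) (U : Set M) : Prop :=
  ContMDiffOn (𝓡 m)
    ((𝓡 m).prod 𝓘(ℝ, EuclideanSpace ℝ (Fin m) →L[ℝ] EuclideanSpace ℝ (Fin m))) ∞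
    (fun x ↦ TotalSpace.mk' (EuclideanSpace ℝ (Fin m) →L[ℝ] EuclideanSpace ℝ (Fin m))
      (E := fun x : M ↦ TangentSpace (𝓡 m) x →L[ℝ] TangentSpace (𝓡 m) x) x (J x)) U

/-- The covariant derivative of the metric:
`(D_v g)(Y, Z) = v (g(Y, Z)) - g(D_v Y, Z) - g(Y, D_v Z)`, for `v ∈ T_x M`. -/
noncomputable def covDerivMetric (D : AffineConnection m M) (g : RiemMetric m M)
    (Y Z : Π x : M, TangentSpace (𝓡 m) x) (x : M) (v : TangentSpace (𝓡 m) x) : ℝ :=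
  mvfderiv (𝓡 m) (fun y ↦ g.inner y (Y y) (Z y)) x v
    - g.inner x (D Y x v) (Z x) - g.inner x (Y x) (D Z x v)

/-- `D g = θ ⊗ g`. -/
def CovDerivMetricEq (D : AffineConnection m M) (g : RiemMetric m M)
    (θ : Π x : M, TangentSpace (𝓡 m) x →L[ℝ] ℝ) : Prop :=
  ∀ (x : M) (Y Z : Π x : M, TangentSpace (𝓡 m) x), DiffFieldAt Y x → DiffFieldAt Z x →
    ∀ v : TangentSpace (𝓡 m) x, covDerivMetric D g Y Z x v = θ x v * g.inner x (Y x) (Z x)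

/-- `D` is the Levi-Civita connection of `g`: it is torsion-free and `D g = 0`. Such a connection
exists, is unique (on differentiable vector fields) and is automatically smooth. -/
structure IsLeviCivita (g : RiemMetric m M) (D : AffineConnection m M) : Prop where
  torsion_free : D.torsion = 0
  metric : CovDerivMetricEq D g (fun _ ↦ 0)

/-- `g'` belongs to the conformal class of `g`: `g' = e^f g` with `f` smooth. -/
def IsConformal (g g' : RiemMetric m M) : Prop :=
  ∃ f : M → ℝ, ContMDiff (𝓡 m) 𝓘(ℝ, ℝ) ∞ f ∧
    ∀ (x : M) (v w : TangentSpace (𝓡 m) x), g'.inner x v w = Real.exp (f x) * g.inner x v w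

/-- `D` is a Weyl connection for the conformal class `c` of `g`: a smooth torsion-free connection
such that for every metric `g' ∈ c` there is a smooth `1`-form `θ` with `D g' = θ ⊗ g'`. -/
structure IsWeylConnection (g : RiemMetric m M) (D : AffineConnection m M) : Prop where
  smooth : CovariantDerivative.ContMDiffCovariantDerivative D ∞
  torsion_free : D.torsion = 0
  preserves : ∀ g' : RiemMetric m M, IsConformal g g' →
    ∃ θ : Π x : M, TangentSpace (𝓡 m) x →L[ℝ] ℝ, SmoothOneForm θ ∧ CovDerivMetricEq D g' θ

variable (m M) in
/-- A field of linear subspaces of the fibres of `End(TM)`. -/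
abbrev EndSubspaceField : Type _ :=
  Π x : M, Submodule ℝ (TangentSpace (𝓡 m) x →L[ℝ] TangentSpace (𝓡 m) x)

/-- `(J 0, J 1, J 2)` is an admissible basis of `H` on the open set `U`: smooth `g`-orthogonal
almost complex structures on `U` which satisfy the quaternionic relations and span `H`
(indices are in `ℤ/3`). -/
structure IsAdmissibleBasis (g : RiemMetric m M) (H : EndSubspaceField m M) (U : Set M)
    (J : Fin 3 → Π x : M, TangentSpace (𝓡 m) x →L[ℝ] TangentSpace (𝓡 m) x) : Prop where
  isOpen : IsOpen U
  smooth : ∀ α, SmoothEndOn (J α) U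
  sq : ∀ α, ∀ x ∈ U, ∀ v, J α x (J α x v) = -v
  mul : ∀ α, ∀ x ∈ U, ∀ v, J α x (J (α + 1) x v) = J (α + 2) x v
  mul_rev : ∀ α, ∀ x ∈ U, ∀ v, J (α + 1) x (J α x v) = -J (α + 2) x v
  orthogonal : ∀ α, ∀ x ∈ U, ∀ v w, g.inner x (J α x v) (J α x w) = g.inner x v w
  span : ∀ x ∈ U, H x = Submodule.span ℝ (range fun α ↦ J α x)

/-- `(M, g, H)` is quaternion(ic) Hermitian: `H` admits an admissible basis near every point.
(The quaternionic relations force `J 0, J 1, J 2` to be linearly independent at each point where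
the tangent space is nonzero, so `H` is then a smooth subbundle of rank `3`; two admissible bases
are always related by a function with values in `SO(3)`.) -/
def IsQuaternionHermitian (g : RiemMetric m M) (H : EndSubspaceField m M) : Prop :=
  ∀ x : M, ∃ U : Set M, x ∈ U ∧ ∃ J, IsAdmissibleBasis g H U J

/-- `D` parallelizes `H`: for every admissible basis `J` of `H` on an open set `U` one has
`D J_α = ∑_β a_{αβ} ⊗ J_β` with a skew-symmetric matrix `a` of `1`-forms, where
`(D_v J) Y = D_v (J Y) - J (D_v Y)`. (The forms `a_{αβ}` are uniquely determined by
this, hence are automatically smooth when `D` is.) -/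
def Parallelizes (D : AffineConnection m M) (g : RiemMetric m M) (H : EndSubspaceField m M) : Prop :=
  ∀ (U : Set M) (J : Fin 3 → Π x : M, TangentSpace (𝓡 m) x →L[ℝ] TangentSpace (𝓡 m) x),
    IsAdmissibleBasis g H U J →
    ∃ a : Fin 3 → Fin 3 → Π x : M, TangentSpace (𝓡 m) x →L[ℝ] ℝ,
      ∀ x ∈ U, (∀ α β, a α β x = -a β α x) ∧
        ∀ Y : Π x : M, TangentSpace (𝓡 m) x, DiffFieldAt Y x →
          ∀ (v : TangentSpace (𝓡 m) x) (α : Fin 3),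
            D (fun y ↦ J α y (Y y)) x v - J α x (D Y x v) = ∑ β, a α β x v • J β x (Y x)

/-- `(M, g, H)` is quaternion Kähler (a notion considered in dimension at least `8`): it is
quaternion Hermitian and the Levi-Civita connection of `g` parallelizes `H`. -/
structure IsQuaternionKahler (g : RiemMetric m M) (H : EndSubspaceField m M) : Prop where
  hermitian : IsQuaternionHermitian g H
  parallel : ∃ D : AffineConnection m M, IsLeviCivita g D ∧ Parallelizes D g H

/-- `(M, g, H)` is quaternion Hermitian Weyl (a notion considered in dimension at least `8`):
`(M, g', H)` is quaternion Hermitian for every `g'` in the conformal class `c` of `g`, and there is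
a Weyl connection `D` of `(M, c)` that parallelizes `H`. -/
structure IsQuaternionHermitianWeyl (g : RiemMetric m M) (H : EndSubspaceField m M) : Prop where
  hermitian : ∀ g' : RiemMetric m M, IsConformal g g' → IsQuaternionHermitian g' H
  weyl : ∃ D : AffineConnection m M, IsWeylConnection g D ∧ Parallelizes D g H

variable {k : ℕ} {Q : Type*} [TopologicalSpace Q] [ChartedSpace (EuclideanSpace ℝ (Fin k)) Q]
  [IsManifold (𝓡 k) ∞ Q]

/-- `gQ` is the metric `j^* g` induced by `g` on `Q`. -/
def IsInducedMetric (g : RiemMetric m M) (j : Q → M) (gQ : RiemMetric k Q) : Prop :=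
  ∀ (q : Q) (v w : TangentSpace (𝓡 k) q),
    gQ.inner q v w = g.inner (j q) (mfderiv (𝓡 k) (𝓡 m) j q v) (mfderiv (𝓡 k) (𝓡 m) j q w)

/-- The tangent spaces of the submanifold `j : Q → M` are invariant under `H`. -/
def TangentInvariant (H : EndSubspaceField m M) (j : Q → M) : Prop :=
  ∀ (q : Q), ∀ B ∈ H (j q), ∀ v : TangentSpace (𝓡 k) q,
    ∃ w : TangentSpace (𝓡 k) q,
      B (mfderiv (𝓡 k) (𝓡 m) j q v) = mfderiv (𝓡 k) (𝓡 m) j q w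

/-- The endomorphisms induced by `H` on the tangent spaces of the submanifold `j : Q → M`:
`A` belongs to the induced field at `q` if it is the restriction to `T_q Q` of some `B ∈ H`. -/
def inducedEnd (H : EndSubspaceField m M) (j : Q → M) : EndSubspaceField k Q := fun q ↦
  { carrier := {A | ∃ B ∈ H (j q), ∀ v : TangentSpace (𝓡 k) q,
      mfderiv (𝓡 k) (𝓡 m) j q (A v) = B (mfderiv (𝓡 k) (𝓡 m) j q v)}
    add_mem' := by
      rintro A A' ⟨B, hB, h⟩ ⟨B', hB', h'⟩
      refine ⟨B + B', add_mem hB hB', fun v ↦ ?_⟩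
      rw [add_apply, add_apply, map_add, h v, h' v]
    zero_mem' := by
      refine ⟨0, zero_mem _, fun v ↦ ?_⟩
      rw [zero_apply, zero_apply, map_zero]
    smul_mem' := by
      rintro c A ⟨B, hB, h⟩
      refine ⟨c • B, Submodule.smul_mem _ c hB, fun v ↦ ?_⟩
      rw [smul_apply, smul_apply, map_smul, h v] }

/-- The submanifold `j : Q → M`, with induced metric `gQ`, is totally geodesic in `(M, g)`: its
second fundamental form `b(v, Y) = D_v Y - DQ_v Y` vanishes, where `D` and `DQ` are the
Levi-Civita connections of `g` and `gQ`. Here a local vector field `Y` on `Q` is differentiated by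
`D` through a local extension `Z` to `M`, i.e. a vector field on `M` such that
`Z (j p) = dj_p (Y p)` for `p` near `q` in `Q`. -/
def IsTotallyGeodesic (g : RiemMetric m M) (j : Q → M) (gQ : RiemMetric k Q) : Prop :=
  ∃ (D : AffineConnection m M) (DQ : AffineConnection k Q),
    IsLeviCivita g D ∧ IsLeviCivita gQ DQ ∧
    ∀ (q : Q) (Y : Π p : Q, TangentSpace (𝓡 k) p) (Z : Π x : M, TangentSpace (𝓡 m) x),
      DiffFieldAt Y q → DiffFieldAt Z (j q) →
      (∀ᶠ p in 𝓝 q, Z (j p) = mfderiv (𝓡 k) (𝓡 m) j p (Y p)) →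
      ∀ v : TangentSpace (𝓡 k) q,
        D Z (j q) (mfderiv (𝓡 k) (𝓡 m) j q v) = mfderiv (𝓡 k) (𝓡 m) j q (DQ Y q v)

end Definitions

/-! If `g` is already quaternion Kähler, `M` itself serves as the submanifold through every point.
Conversely, let `D` be the Weyl connection parallelizing `H`, with `D g = θ ⊗ g`. If `θ = 0`, then
`D` is the Levi-Civita connection of `g`, so it suffices to show `θ = 0` at each point, using the
submanifold `Q` through it.

Let `S` be the difference between `D` and the Levi-Civita connection; the Koszul trick expresses it
through `θ`. On fields tangent to `Q` the Levi-Civita connection of `M` is that of `Q`, which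
parallelizes the restriction of `H`, while `D` parallelizes `H`. Hence on `TQ` the endomorphisms
`S(·, X)` commute with a complex structure `B ∈ H` up to elements of `H` (`exists_diffTensor_comm`).

The rest is linear algebra (`weylForm_eq_zero`). Since `dim TQ > 4`, each `Y` in `TQ` has a nonzero
`X` in `TQ` orthogonal to its quaternionic line; testing the relation on `X` gives `θ(BY) = 0`, so
`θ` vanishes on `TQ`. Taking `X = Y` then kills `θ` in all remaining directions. -/

/-! ### Linear algebra of quaternion Hermitian vector spaces. -/

section LinearAlgebra

variable {V : Type*} [AddCommGroup V] [Module ℝ V] [TopologicalSpace V]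

/-- The quaternionic relations for a triple of endomorphisms which are orthogonal for `g`. -/
structure IsHermitianTriple (g : V →L[ℝ] V →L[ℝ] ℝ) (J : Fin 3 → V →L[ℝ] V) : Prop where
  symm : ∀ v w, g v w = g w v
  pos : ∀ v, v ≠ 0 → 0 < g v v
  sq : ∀ α v, J α (J α v) = -v
  mul : ∀ α v, J α (J (α + 1) v) = J (α + 2) v
  mul_rev : ∀ α v, J (α + 1) (J α v) = -J (α + 2) v
  orthogonal : ∀ α v w, g (J α v) (J α w) = g v w

namespace IsHermitianTriple

variable {g : V →L[ℝ] V →L[ℝ] ℝ} {J : Fin 3 → V →L[ℝ] V}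

lemma skew (h : IsHermitianTriple g J) (α : Fin 3) (v w : V) : g (J α v) w = -g v (J α w) := by
  rw [← h.orthogonal α v (J α w), h.sq, map_neg, neg_neg]

lemma inner_apply_self (h : IsHermitianTriple g J) (α : Fin 3) (v : V) : g (J α v) v = 0 := by
  have h1 := h.skew α v v
  rw [h.symm v] at h1
  linarith

lemma inner_apply_succ (h : IsHermitianTriple g J) (α : Fin 3) (v : V) :
    g (J α v) (J (α + 1) v) = 0 := by
  rw [h.skew, h.mul, h.symm, h.inner_apply_self, neg_zero]

lemma inner_apply_apply (h : IsHermitianTriple g J) (α β : Fin 3) (v : V) :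
    g (J α v) (J β v) = if α = β then g v v else 0 := by
  have h0 := h.inner_apply_succ 0 v
  have h1 := h.inner_apply_succ 1 v
  have h2 := h.inner_apply_succ 2 v
  fin_cases α <;> fin_cases β <;> simp [h.orthogonal] <;>
    first | exact h0 | exact h1 | exact h2 | exact (h.symm _ _).trans h0 |
      exact (h.symm _ _).trans h1 | exact (h.symm _ _).trans h2

lemma inner_sum_smul_apply (h : IsHermitianTriple g J) (r : Fin 3 → ℝ) (β : Fin 3) (v : V) :
    g (∑ α, r α • J α v) (J β v) = r β * g v v := by
  simp [map_sum, h.inner_apply_apply]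

lemma sum_smul_sq (h : IsHermitianTriple g J) (r : Fin 3 → ℝ) (v : V) :
    ∑ α, r α • J α (∑ β, r β • J β v) = -(∑ α, r α ^ 2) • v := by
  have m0 := h.mul 0 v
  have m1 := h.mul 1 v
  have m2 := h.mul 2 v
  have n0 := h.mul_rev 0 v
  have n1 := h.mul_rev 1 v
  have n2 := h.mul_rev 2 v
  have s0 := h.sq 0 v
  have s1 := h.sq 1 v
  have s2 := h.sq 2 v
  simp only [Fin.isValue, Fin.reduceAdd, zero_add] at m0 m1 m2 n0 n1 n2
  simp only [Fin.sum_univ_three, map_add, map_smul, m0, m1, m2, n0, n1, n2, s0, s1, s2]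
  module

lemma sum_smul_skew (h : IsHermitianTriple g J) (r : Fin 3 → ℝ) (v w : V) :
    g (∑ α, r α • J α v) w = -g v (∑ α, r α • J α w) := by
  simp [map_sum, h.skew]

/-- Let `S` be the difference tensor of a Weyl connection with form `θ` and the Levi-Civita
connection. If `S` commutes with some `B = ∑ r_α J_α` up to the span of the `J_β` on an invariant
subspace of dimension greater than `4`, then `θ = 0`. -/
theorem weylForm_eq_zero (h : IsHermitianTriple g J) (S : V → V → V) (θ : V →L[ℝ] ℝ)
    (hS : ∀ X Y Z, 2 * g (S Y X) Z = -(θ X * g Y Z + θ Y * g X Z - θ Z * g X Y))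
    (T : Submodule ℝ V) [FiniteDimensional ℝ T] (hT : 4 < Module.finrank ℝ T)
    (hJT : ∀ α, ∀ v ∈ T, J α v ∈ T) (r : Fin 3 → ℝ)
    (hr : ∀ v ∈ T, ∑ α, r α • J α (∑ β, r β • J β v) = -v)
    (hcomm : ∀ X ∈ T, ∀ Y ∈ T, Y ≠ 0 → ∃ c : Fin 3 → ℝ,
      S (∑ α, r α • J α Y) X - ∑ α, r α • J α (S Y X) = ∑ β, c β • J β Y) :
    θ = 0 := by
  set B : V → V := fun v ↦ ∑ α, r α • J α v with hB
  have hBT (v) (hv : v ∈ T) : B v ∈ T :=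
    T.sum_mem fun α _ ↦ T.smul_mem _ (hJT α v hv)
  have hskew (v w) : g (B v) w = -g v (B w) := h.sum_smul_skew r v w
  obtain ⟨e, he⟩ : ∃ e : T, e ≠ 0 := by
    have : Nontrivial T := Module.nontrivial_of_finrank_pos (R := ℝ) (by omega)
    exact exists_ne 0
  have hBB (v : V) : B (B v) = -v := by
    have h1 : B (B e) = -(∑ α, r α ^ 2) • (e : V) := h.sum_smul_sq r e
    have h2 : B (B e) = -(e : V) := hr e e.2
    have h3 : (∑ α, r α ^ 2 - 1) • (e : V) = 0 := by
      rw [h1] at h2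
      rw [sub_smul, one_smul, sub_eq_zero]
      simpa using h2
    have h4 : ∑ α, r α ^ 2 = 1 := by
      rcases smul_eq_zero.1 h3 with h | h
      · linarith
      · exact absurd (Subtype.ext h) he
    rw [show B (B v) = -(∑ α, r α ^ 2) • v from h.sum_smul_sq r v, h4]
    simp
  have hθB (Y) (hY : Y ∈ T) : θ (B Y) = 0 := by
    by_cases hY0 : Y = 0
    · simp [hB, hY0]
    -- The kernel of `F` is the orthogonal complement in `T` of the quaternionic line of `Y`; it is
    -- nonzero because `dim T > 4`.
    let F : T →ₗ[ℝ] (Fin 4 → ℝ) := LinearMap.pi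
      (Fin.cons ((g Y).toLinearMap ∘ₗ T.subtype) fun α ↦ (g (J α Y)).toLinearMap ∘ₗ T.subtype)
    obtain ⟨X, hXF, hX0⟩ : ∃ X ∈ LinearMap.ker F, X ≠ 0 := by
      apply Submodule.exists_mem_ne_zero_of_ne_bot
      apply LinearMap.ker_ne_bot_of_finrank_lt
      simpa using hT
    have hX1 : g Y X = 0 := by simpa [F] using congrFun hXF 0
    have hX2 (α : Fin 3) : g (J α Y) X = 0 := by simpa [F] using congrFun hXF α.succ
    obtain ⟨c, hc⟩ := hcomm X X.2 Y hY hY0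
    -- Pairing with `X` kills the right-hand side and every term of the formula for `S` except `θ (B
    -- Y) * g X X`.
    have h1 := congrArg (fun v ↦ g v X) hc
    simp only [map_sub, sub_apply, map_sum, sum_apply,
      map_smul, smul_apply, hX2, smul_zero, Finset.sum_const_zero] at h1
    have hBY : g (B Y) X = 0 := by
      simp [hB, map_sum, hX2]
    have h2 := hS X (B Y) X
    have h3 : g (∑ α, r α • J α (S Y X)) X = -g (S Y X) (B X) := hskew _ _
    have h4 := hS X Y (B X)
    have h5 : g Y (B X) = 0 := by have := hskew Y X; linarith
    have h6 : g X (B X) = 0 := by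
      have := hskew X X
      rw [h.symm (B (X : V))] at this
      linarith
    rw [h.symm X Y, hX1, h5, h6] at h4
    rw [h.symm X (B Y), hBY] at h2
    simp only [map_sum, map_smul, sum_apply, smul_apply]
      at h3
    rw [h3] at h1
    change g (S (B Y) X) X - _ = 0 at h1
    have h7 : θ (B Y) * g X X = 0 := by linarith
    exact (mul_eq_zero.1 h7).resolve_right (h.pos X (by simpa using hX0)).ne'
  have hθT (Y) (hY : Y ∈ T) : θ Y = 0 := by
    have := hθB _ (hBT Y hY)
    rwa [hBB, map_neg, neg_eq_zero] at this
  have he' : (e : V) ≠ 0 := by simpa using he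
  -- With `X = Y = e` and `θ = 0` on `T`, only the term of `S` dual to `θ` survives, and it sees all
  -- directions of `V`.
  obtain ⟨c, hc⟩ := hcomm e e.2 e e.2 he'
  have key (Z : V) : θ (B Z) * g e e = 2 * g (∑ β, c β • J β e) Z := by
    rw [← hc, map_sub, sub_apply]
    have h2 := hS e (B e) Z
    have h3 : g (∑ α, r α • J α (S e e)) Z = -g (S e e) (B Z) := hskew _ _
    have h4 := hS e e (B Z)
    have h6 : g e (B e) = 0 := by
      have := hskew e e
      rw [h.symm (B (e : V))] at this
      linarith
    have h7 := hskew e Z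
    rw [hθT e e.2, hθT _ (hBT e e.2), h6] at h2
    rw [hθT e e.2] at h4
    rw [h3]
    change _ = 2 * (g (S (B e) e) Z - _)
    linarith
  have hCT : ∑ β, c β • J β (e : V) ∈ T := T.sum_mem fun α _ ↦ T.smul_mem _ (hJT α e e.2)
  have hC : ∑ β, c β • J β (e : V) = 0 := by
    by_contra hne
    -- Testing against the vector itself, which lies in `T`, the left side vanishes and the right
    -- side is twice its squared norm.
    have h1 := key (∑ β, c β • J β e)
    rw [hθB _ hCT] at h1
    have := h.pos _ hne
    linarith
  ext Z
  have h1 := key (-B Z)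
  rw [hC] at h1
  have h2 : B (-B Z) = Z := by
    have : B (-B Z) = -B (B Z) := by simp [hB]
    rw [this, hBB, neg_neg]
  rw [h2] at h1
  simpa [(h.pos e he').ne'] using h1

end IsHermitianTriple

end LinearAlgebra

/-! ### Difference tensors of affine connections and the Koszul formula. -/

section Connections

variable {m : ℕ} {M : Type*} [TopologicalSpace M] [ChartedSpace (EuclideanSpace ℝ (Fin m)) M]
  [IsManifold (𝓡 m) ∞ M]

lemma IsConformal.refl (g : RiemMetric m M) : IsConformal g g :=
  ⟨fun _ ↦ 0, contMDiff_const, by simp⟩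

lemma exists_diffFieldAt_eq (x : M) (v : TangentSpace (𝓡 m) x) :
    ∃ Y : Π x : M, TangentSpace (𝓡 m) x, DiffFieldAt Y x ∧ Y x = v :=
  ⟨FiberBundle.extend (EuclideanSpace ℝ (Fin m)) v,
    FiberBundle.mdifferentiableAt_extend .., by simp⟩

namespace DiffFieldAt

variable {x : M} {Y Z : Π x : M, TangentSpace (𝓡 m) x}

lemma smul {f : M → ℝ} (hf : MDifferentiableAt (𝓡 m) 𝓘(ℝ, ℝ) f x) (hY : DiffFieldAt Y x) :
    DiffFieldAt (f • Y) x :=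
  MDifferentiableAt.smul_section hf hY

lemma add (hY : DiffFieldAt Y x) (hZ : DiffFieldAt Z x) : DiffFieldAt (Y + Z) x :=
  mdifferentiableAt_add_section hY hZ

lemma end_apply {U : Set M} (hU : IsOpen U) (hx : x ∈ U)
    {J : Π x : M, TangentSpace (𝓡 m) x →L[ℝ] TangentSpace (𝓡 m) x} (hJ : SmoothEndOn J U)
    (hY : DiffFieldAt Y x) : DiffFieldAt (fun y ↦ J y (Y y)) x :=
  MDifferentiableAt.clm_bundle_apply (F₁ := EuclideanSpace ℝ (Fin m))
    (E₁ := fun x : M ↦ TangentSpace (𝓡 m) x) (F₂ := EuclideanSpace ℝ (Fin m))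
    (E₂ := fun x : M ↦ TangentSpace (𝓡 m) x) (b := id) (ϕ := J)
    ((hJ.contMDiffAt (hU.mem_nhds hx)).mdifferentiableAt (by simp)) hY

lemma inner (g : RiemMetric m M) (hY : DiffFieldAt Y x) (hZ : DiffFieldAt Z x) :
    MDifferentiableAt (𝓡 m) 𝓘(ℝ, ℝ) (fun y ↦ g.inner y (Y y) (Z y)) x := by
  have h := MDifferentiableAt.clm_bundle_apply₂ (F₁ := EuclideanSpace ℝ (Fin m))
    (E₁ := fun x : M ↦ TangentSpace (𝓡 m) x) (F₂ := EuclideanSpace ℝ (Fin m))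
    (E₂ := fun x : M ↦ TangentSpace (𝓡 m) x) (F₃ := ℝ) (E₃ := Bundle.Trivial M ℝ)
    (b := id) (ψ := g.inner)
    ((g.contMDiff x).mdifferentiableAt (by simp)) hY hZ
  exact (mdifferentiableAt_section _ _).1 h

end DiffFieldAt

/-- The difference tensor of two affine connections, with
`diffTensor D D' x (Y x) v = D_v Y - D'_v Y`. -/
noncomputable def diffTensor (D D' : AffineConnection m M) (x : M) :
    TangentSpace (𝓡 m) x →L[ℝ] TangentSpace (𝓡 m) x →L[ℝ] TangentSpace (𝓡 m) x :=
  D.isCovariantDerivativeOnUniv.difference D'.isCovariantDerivativeOnUniv x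

variable {D D' : AffineConnection m M} {x : M}

lemma diffTensor_apply {Y : Π x : M, TangentSpace (𝓡 m) x} (hY : DiffFieldAt Y x)
    (v : TangentSpace (𝓡 m) x) : diffTensor D D' x (Y x) v = D Y x v - D' Y x v :=
  congrArg (fun A : TangentSpace (𝓡 m) x →L[ℝ] TangentSpace (𝓡 m) x ↦ A v)
    (IsCovariantDerivativeOn.difference_apply D.isCovariantDerivativeOnUniv
      D'.isCovariantDerivativeOnUniv (mem_univ x) hY)

lemma diffTensor_symm (hD : D.torsion = 0) (hD' : D'.torsion = 0)
    (v w : TangentSpace (𝓡 m) x) : diffTensor D D' x v w = diffTensor D D' x w v := by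
  obtain ⟨Y, hY, rfl⟩ := exists_diffFieldAt_eq x v
  obtain ⟨Z, hZ, rfl⟩ := exists_diffFieldAt_eq x w
  have h1 := (CovariantDerivative.torsion_eq_zero_iff D).1 hD hY hZ
  have h2 := (CovariantDerivative.torsion_eq_zero_iff D').1 hD' hY hZ
  rw [diffTensor_apply hY, diffTensor_apply hZ, ← sub_eq_zero]
  rw [← h2, ← sub_eq_zero] at h1
  rw [← neg_eq_zero, ← h1]
  abel

/-- The Koszul formula for the difference tensor of a Weyl connection and the Levi-Civita
connection. -/
lemma two_mul_inner_diffTensor {g : RiemMetric m M}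
    {θ : Π x : M, TangentSpace (𝓡 m) x →L[ℝ] ℝ} (hD : D.torsion = 0)
    (hDg : CovDerivMetricEq D g θ) (hD' : IsLeviCivita g D') (X Y Z : TangentSpace (𝓡 m) x) :
    2 * g.inner x (diffTensor D D' x Y X) Z =
      -(θ x X * g.inner x Y Z + θ x Y * g.inner x X Z - θ x Z * g.inner x X Y) := by
  have key (X Y Z : TangentSpace (𝓡 m) x) : g.inner x (diffTensor D D' x Y X) Z +
      g.inner x (diffTensor D D' x Z X) Y = -(θ x X * g.inner x Y Z) := by
    obtain ⟨Y, hY, rfl⟩ := exists_diffFieldAt_eq x Y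
    obtain ⟨Z, hZ, rfl⟩ := exists_diffFieldAt_eq x Z
    have h1 := hDg x Y Z hY hZ X
    have h2 := hD'.metric x Y Z hY hZ X
    rw [covDerivMetric] at h1 h2
    rw [diffTensor_apply hY, diffTensor_apply hZ, g.symm x _ (Y x), map_sub, map_sub,
      sub_apply]
    simp only [zero_apply, zero_mul] at h2
    linarith
  -- Koszul trick: add two cyclic instances of `key` and subtract the third, using the symmetry of
  -- the difference tensor.
  have s := diffTensor_symm (x := x) hD hD'.torsion_free
  have h1 := key X Y Z
  have h2 := key Y Z X
  have h3 := key Z X Y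
  rw [s X Z] at h3
  rw [s X Y, s Z Y] at h2
  rw [g.symm x Z X] at h2
  rw [s Z X] at h1
  rw [s Y Z] at h3
  simp only [s Y X, s Y Z, s X Z] at h1 h2 h3 ⊢
  linarith

/-- Uniqueness of the Levi-Civita connection: the Koszul formula with `θ = 0`, tested on the
difference vector itself. -/
lemma IsLeviCivita.apply_eq {g : RiemMetric m M} (hD : IsLeviCivita g D) (hD' : IsLeviCivita g D')
    {Y : Π x : M, TangentSpace (𝓡 m) x} (hY : DiffFieldAt Y x) (v : TangentSpace (𝓡 m) x) :
    D Y x v = D' Y x v := by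
  rw [← sub_eq_zero, ← diffTensor_apply hY]
  by_contra hne
  have h1 := g.pos x _ hne
  have h2 := two_mul_inner_diffTensor hD.torsion_free hD.metric hD' v (Y x)
    (diffTensor D D' x (Y x) v)
  simp only [zero_apply, zero_mul] at h2
  linarith

end Connections

/-! ### Immersed submanifolds: local retractions and extension of vector fields. -/

section Submanifolds

variable {m : ℕ} {M : Type*} [TopologicalSpace M] [ChartedSpace (EuclideanSpace ℝ (Fin m)) M]
  {k : ℕ} {Q : Type*} [TopologicalSpace Q] [ChartedSpace (EuclideanSpace ℝ (Fin k)) Q]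
  {j : Q → M}

/-- In adapted charts an immersion is the inclusion of a factor, and the retraction is the
projection `L` onto it. -/
lemma Manifold.IsImmersion.exists_local_retraction
    (hj : Manifold.IsImmersion (𝓡 k) (𝓡 m) ∞ j) (q : Q) :
    ∃ ρ : M → Q, MDifferentiableAt (𝓡 m) (𝓡 k) ρ (j q) ∧ ∀ᶠ p in 𝓝 q, ρ (j p) = p := by
  have h := hj.isImmersionAt q
  set φ := h.domChart.extend (𝓡 k)
  set ψ := h.codChart.extend (𝓡 m)
  let L : EuclideanSpace ℝ (Fin m) →L[ℝ] EuclideanSpace ℝ (Fin k) :=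
    ContinuousLinearMap.fst ℝ _ _ ∘L h.equiv.symm.toContinuousLinearMap
  have hLψ (p) (hp : p ∈ h.domChart.source) : L (ψ (j p)) = φ p := by
    have hp' : p ∈ φ.source := by simpa [φ] using hp
    have h1 := h.writtenInCharts (φ.map_source hp')
    simp only [Function.comp_apply] at h1
    rw [show (h.domChart.extend (𝓡 k)).symm (φ p) = p from φ.left_inv hp'] at h1
    change ψ (j p) = _ at h1
    simp [L, h1]
  refine ⟨fun y ↦ φ.symm (L (ψ y)), ?_, ?_⟩
  · have h1 : MDifferentiableAt (𝓡 m) 𝓘(ℝ, EuclideanSpace ℝ (Fin m)) ψ (j q) :=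
      (h.codChart.contMDiffAt_extend h.codChart_mem_maximalAtlas
        h.mem_codChart_source).mdifferentiableAt (by simp)
    have h2 : MDifferentiableAt (𝓡 m) 𝓘(ℝ, EuclideanSpace ℝ (Fin k)) (fun y ↦ L (ψ y)) (j q) :=
      (L.differentiableAt.mdifferentiableAt).comp (j q) h1
    have h3 : MDifferentiableAt 𝓘(ℝ, EuclideanSpace ℝ (Fin k)) (𝓡 k) φ.symm (L (ψ (j q))) := by
      rw [hLψ q h.mem_domChart_source]
      refine ((contMDiffOn_extend_symm h.domChart_mem_maximalAtlas).contMDiffAt ?_).mdifferentiableAt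
        (by simp)
      have : (𝓡 k) '' h.domChart.target = h.domChart.target := by simp
      rw [this]
      exact h.domChart.open_target.mem_nhds (h.domChart.map_source h.mem_domChart_source)
    exact h3.comp (j q) h2
  · filter_upwards [h.domChart.open_source.mem_nhds h.mem_domChart_source] with p hp
    rw [hLψ p hp]
    exact φ.left_inv (by simpa [φ] using hp)

lemma Manifold.IsImmersion.mfderiv_injective
    (hj : Manifold.IsImmersion (𝓡 k) (𝓡 m) ∞ j) (q : Q) :
    Function.Injective (mfderiv (𝓡 k) (𝓡 m) j q) := by
  obtain ⟨ρ, hρ, hρj⟩ := hj.exists_local_retraction q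
  have h1 : HasMFDerivAt (𝓡 k) (𝓡 k) (ρ ∘ j) q
      (mfderiv (𝓡 m) (𝓡 k) ρ (j q) ∘L mfderiv (𝓡 k) (𝓡 m) j q) :=
    hρ.hasMFDerivAt.comp q ((hj.contMDiff q).mdifferentiableAt (by simp)).hasMFDerivAt
  have h2 : HasMFDerivAt (𝓡 k) (𝓡 k) (ρ ∘ j) q (ContinuousLinearMap.id ℝ _) :=
    (hasMFDerivAt_id q).congr_of_eventuallyEq hρj
  have h3 := hasMFDerivAt_unique h1 h2
  exact Function.LeftInverse.injective
    (g := mfderiv (𝓡 m) (𝓡 k) ρ (j q)) fun v ↦ congrArg (fun A ↦ A v) h3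

variable [IsManifold (𝓡 m) ∞ M] [IsManifold (𝓡 k) ∞ Q]

/-- A vector field on an immersed submanifold extends locally to the ambient manifold. -/
lemma Manifold.IsImmersion.exists_extension
    (hj : Manifold.IsImmersion (𝓡 k) (𝓡 m) ∞ j) {q : Q}
    {Y : Π p : Q, TangentSpace (𝓡 k) p} (hY : DiffFieldAt Y q) :
    ∃ Z : Π x : M, TangentSpace (𝓡 m) x, DiffFieldAt Z (j q) ∧
      ∀ᶠ p in 𝓝 q, Z (j p) = mfderiv (𝓡 k) (𝓡 m) j p (Y p) := by
  obtain ⟨ρ, hρ, hρj⟩ := hj.exists_local_retraction q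
  have hρq : ρ (j q) = q := hρj.self_of_nhds
  let e := trivializationAt (EuclideanSpace ℝ (Fin m)) (fun x : M ↦ TangentSpace (𝓡 m) x) (j q)
  let s : Q → TangentBundle (𝓡 m) M := fun p ↦ ⟨j p, mfderiv (𝓡 k) (𝓡 m) j p (Y p)⟩
  have hs : MDifferentiableAt (𝓡 k) (𝓡 m).tangent s q := by
    have h1 : ContMDiff (𝓡 k).tangent (𝓡 m).tangent 1 (tangentMap (𝓡 k) (𝓡 m) j) :=
      hj.contMDiff.contMDiff_tangentMap (by norm_cast)
    exact MDifferentiableAt.comp (I' := (𝓡 k).tangent) q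
      ((h1 _).mdifferentiableAt (by simp)) hY
  have hW : MDifferentiableAt (𝓡 k) 𝓘(ℝ, EuclideanSpace ℝ (Fin m)) (fun p ↦ (e (s p)).2) q :=
    ((mdifferentiableAt_totalSpace _ s).1 hs).2
  -- In a trivialization of `TM` near `j q`, the coordinates of the pushed-forward field are
  -- extended to be constant along the fibres of `ρ`.
  refine ⟨fun y ↦ e.symm y (e (s (ρ y))).2, ?_, ?_⟩
  · refine (mdifferentiableAt_section _ _).2 ?_
    have h1 : MDifferentiableAt (𝓡 m) 𝓘(ℝ, EuclideanSpace ℝ (Fin m))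
        (fun y ↦ (e (s (ρ y))).2) (j q) := by
      rw [← hρq] at hW
      exact hW.comp (j q) hρ
    refine h1.congr_of_eventuallyEq ?_
    filter_upwards [e.open_baseSet.mem_nhds
      (FiberBundle.mem_baseSet_trivializationAt' (j q))] with y hy
    have h2 : e ⟨y, e.symm y (e (s (ρ y))).2⟩ = (y, (e (s (ρ y))).2) := e.apply_mk_symm hy _
    have h3 := congrArg Prod.snd h2
    exact h3
  · filter_upwards [hρj, hj.contMDiff.continuous.continuousAt.preimage_mem_nhds
      (e.open_baseSet.mem_nhds (FiberBundle.mem_baseSet_trivializationAt' (j q)))] with p hp hp'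
    rw [hp]
    exact e.symm_apply_apply_mk hp' _

end Submanifolds

/-! ### Comparison of the quaternionic structures of `M` and `Q`. -/

section QuaternionicStructures

variable {m : ℕ} {M : Type*} [TopologicalSpace M] [ChartedSpace (EuclideanSpace ℝ (Fin m)) M]
  [IsManifold (𝓡 m) ∞ M] {g : RiemMetric m M} {H : EndSubspaceField m M} {U : Set M}
  {J : Fin 3 → Π x : M, TangentSpace (𝓡 m) x →L[ℝ] TangentSpace (𝓡 m) x}

namespace IsAdmissibleBasis

lemma isHermitianTriple (hJ : IsAdmissibleBasis g H U J) {x : M} (hx : x ∈ U) :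
    IsHermitianTriple (g.inner x) fun α ↦ J α x where
  symm := g.symm x
  pos := g.pos x
  sq α := hJ.sq α x hx
  mul α := hJ.mul α x hx
  mul_rev α := hJ.mul_rev α x hx
  orthogonal α := hJ.orthogonal α x hx

lemma mem (hJ : IsAdmissibleBasis g H U J) {x : M} (hx : x ∈ U) (α : Fin 3) : J α x ∈ H x := by
  rw [hJ.span x hx]
  exact Submodule.subset_span ⟨α, rfl⟩

lemma exists_eq_sum (hJ : IsAdmissibleBasis g H U J) {x : M} (hx : x ∈ U)
    {B : TangentSpace (𝓡 m) x →L[ℝ] TangentSpace (𝓡 m) x} (hB : B ∈ H x) :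
    ∃ r : Fin 3 → ℝ, ∀ v, B v = ∑ α, r α • J α x v := by
  rw [hJ.span x hx, Submodule.mem_span_range_iff_exists_fun] at hB
  obtain ⟨r, rfl⟩ := hB
  exact ⟨r, fun v ↦ by simp⟩

variable {k : ℕ} {Q : Type*} [TopologicalSpace Q] [ChartedSpace (EuclideanSpace ℝ (Fin k)) Q]
  [IsManifold (𝓡 k) ∞ Q] {j : Q → M} {gQ : RiemMetric k Q} {V : Set Q}
  {K : Fin 3 → Π p : Q, TangentSpace (𝓡 k) p →L[ℝ] TangentSpace (𝓡 k) p}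

lemma exists_mfderiv_apply_eq_sum (hJ : IsAdmissibleBasis g H U J)
    (hK : IsAdmissibleBasis gQ (inducedEnd H j) V K) (α : Fin 3) {p : Q} (hp : p ∈ V)
    (hpU : j p ∈ U) :
    ∃ r : Fin 3 → ℝ, ∀ v, mfderiv (𝓡 k) (𝓡 m) j p (K α p v) =
      ∑ β, r β • J β (j p) (mfderiv (𝓡 k) (𝓡 m) j p v) := by
  obtain ⟨B, hB, hBK⟩ := hK.mem hp α
  obtain ⟨r, hr⟩ := hJ.exists_eq_sum hpU hB
  exact ⟨r, fun v ↦ by rw [hBK, hr]⟩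

/-- Over a totally geodesic quaternion Kähler submanifold, the difference tensor of an ambient
connection parallelizing `H` and the Levi-Civita connection commutes with the almost complex
structures up to `H`. -/
theorem exists_diffTensor_comm (hJ : IsAdmissibleBasis g H U J)
    (hK : IsAdmissibleBasis gQ (inducedEnd H j) V K)
    (hj : Manifold.IsImmersion (𝓡 k) (𝓡 m) ∞ j) {D D' : AffineConnection m M}
    (hDH : Parallelizes D g H) {DQ : AffineConnection k Q}
    (hDQ : Parallelizes DQ gQ (inducedEnd H j)) {q : Q}
    (hgeo : ∀ (Y : Π p : Q, TangentSpace (𝓡 k) p) (Z : Π x : M, TangentSpace (𝓡 m) x),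
      DiffFieldAt Y q → DiffFieldAt Z (j q) →
      (∀ᶠ p in 𝓝 q, Z (j p) = mfderiv (𝓡 k) (𝓡 m) j p (Y p)) →
      ∀ v : TangentSpace (𝓡 k) q,
        D' Z (j q) (mfderiv (𝓡 k) (𝓡 m) j q v) = mfderiv (𝓡 k) (𝓡 m) j q (DQ Y q v))
    (hq : q ∈ V) (hqU : j q ∈ U) :
    ∃ r : Fin 3 → ℝ,
      (∀ v, mfderiv (𝓡 k) (𝓡 m) j q (K 0 q v) =
        ∑ β, r β • J β (j q) (mfderiv (𝓡 k) (𝓡 m) j q v)) ∧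
      ∀ X Y : TangentSpace (𝓡 k) q, Y ≠ 0 → ∃ c : Fin 3 → ℝ,
        diffTensor D D' (j q) (∑ β, r β • J β (j q) (mfderiv (𝓡 k) (𝓡 m) j q Y))
            (mfderiv (𝓡 k) (𝓡 m) j q X) -
          ∑ β, r β • J β (j q) (diffTensor D D' (j q) (mfderiv (𝓡 k) (𝓡 m) j q Y)
            (mfderiv (𝓡 k) (𝓡 m) j q X)) =
        ∑ β, c β • J β (j q) (mfderiv (𝓡 k) (𝓡 m) j q Y) := by
  have hjc : ContinuousAt j q := hj.contMDiff.continuous.continuousAt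
  have hUq : ∀ᶠ p in 𝓝 q, j p ∈ U := hjc.preimage_mem_nhds (hJ.isOpen.mem_nhds hqU)
  have hex : ∀ᶠ p in 𝓝 q, ∃ r : Fin 3 → ℝ, ∀ v, mfderiv (𝓡 k) (𝓡 m) j p (K 0 p v) =
      ∑ β, r β • J β (j p) (mfderiv (𝓡 k) (𝓡 m) j p v) := by
    filter_upwards [hK.isOpen.mem_nhds hq, hUq] with p hp hpU
    exact exists_mfderiv_apply_eq_sum hJ hK 0 hp hpU
  -- `R` is chosen pointwise and carries no regularity; the functions `f β` below supply it.
  obtain ⟨R, hR⟩ := hex.choice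
  have hRq := hR.self_of_nhds
  refine ⟨R q, hRq, fun X v hv ↦ ?_⟩
  obtain ⟨Y, hY, rfl⟩ := exists_diffFieldAt_eq q v
  have hKY : DiffFieldAt (fun p ↦ K 0 p (Y p)) q := hY.end_apply hK.isOpen hq (hK.smooth 0)
  obtain ⟨Z, hZ, hZY⟩ := hj.exists_extension hY
  obtain ⟨Z₀, hZ₀, hZ₀Y⟩ := hj.exists_extension hKY
  have hZq : Z (j q) = mfderiv (𝓡 k) (𝓡 m) j q (Y q) := hZY.self_of_nhds
  have hZ0 : Z (j q) ≠ 0 := by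
    rw [hZq]
    exact fun h ↦ hv (hj.mfderiv_injective q (h.trans (map_zero _).symm))
  have hgZ := DiffFieldAt.inner g hZ hZ
  have hgZ0 : g.inner (j q) (Z (j q)) (Z (j q)) ≠ 0 := (g.pos _ _ hZ0).ne'
  have hW (β : Fin 3) : DiffFieldAt (fun y ↦ J β y (Z y)) (j q) :=
    hZ.end_apply hJ.isOpen hqU (hJ.smooth β)
  -- The `J β Z` are orthogonal of the same length as `Z`, so this quotient recovers `R p β` along
  -- `Q` and is differentiable on `M` at `j q`. This is where `Y ≠ 0` enters.
  let f (β : Fin 3) (y : M) : ℝ := g.inner y (Z₀ y) (J β y (Z y)) / g.inner y (Z y) (Z y)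
  have hf (β : Fin 3) : MDifferentiableAt (𝓡 m) 𝓘(ℝ, ℝ) (f β) (j q) := by
    simp only [f, div_eq_mul_inv]
    exact MDifferentiableAt.mul (DiffFieldAt.inner g hZ₀ (hW β))
      ((differentiableAt_inv hgZ0).mdifferentiableAt.comp (j q) hgZ)
  have hfR : ∀ᶠ p in 𝓝 q, ∀ β, f β (j p) = R p β := by
    have h1 : ∀ᶠ p in 𝓝 q, g.inner (j p) (Z (j p)) (Z (j p)) ≠ 0 :=
      hjc.eventually (hgZ.continuousAt.eventually_ne hgZ0)
    filter_upwards [h1, hR, hZY, hZ₀Y, hUq] with p h1 hR hZY hZ₀Y hpU β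
    rw [div_eq_iff h1, hZ₀Y, hR, ← hZY]
    exact (hJ.isHermitianTriple hpU).inner_sum_smul_apply _ _ _
  let W (β : Fin 3) : Π x : M, TangentSpace (𝓡 m) x := fun y ↦ J β y (Z y)
  -- Another extension of `K 0 Y`, replacing `Z₀`: its form as a combination of the `J β Z` lets the
  -- Leibniz rule and `hDH` compute `D Z'`.
  let Z' : Π x : M, TangentSpace (𝓡 m) x := f 0 • W 0 + (f 1 • W 1 + f 2 • W 2)
  have hfW (β : Fin 3) : DiffFieldAt (f β • W β) (j q) := (hW β).smul (hf β)
  have hZ' : DiffFieldAt Z' (j q) := (hfW 0).add ((hfW 1).add (hfW 2))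
  have hZ'Y : ∀ᶠ p in 𝓝 q, Z' (j p) = mfderiv (𝓡 k) (𝓡 m) j p (K 0 p (Y p)) := by
    filter_upwards [hfR, hR, hZY] with p hfR hR hZY
    rw [hR, ← hZY, Fin.sum_univ_three, ← hfR, ← hfR, ← hfR, add_assoc]
    rfl
  have hZ'q := hZ'Y.self_of_nhds
  have hDZ' (w : TangentSpace (𝓡 m) (j q)) : D Z' (j q) w =
      ∑ β, (R q β • D (W β) (j q) w + mvfderiv (𝓡 m) (f β) (j q) w • J β (j q) (Z (j q))) := by
    have h1 (β : Fin 3) : D (f β • W β) (j q) w =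
        R q β • D (W β) (j q) w + mvfderiv (𝓡 m) (f β) (j q) w • J β (j q) (Z (j q)) := by
      rw [D.isCovariantDerivativeOnUniv.leibniz (hW β) (hf β), ← hfR.self_of_nhds β]
      rfl
    rw [D.isCovariantDerivativeOnUniv.add (hfW 0) ((hfW 1).add (hfW 2)),
      D.isCovariantDerivativeOnUniv.add (hfW 1) (hfW 2), Fin.sum_univ_three, add_assoc,
      ← h1, ← h1, ← h1]
    rfl
  obtain ⟨a, ha⟩ := hDH U J hJ
  obtain ⟨b, hb⟩ := hDQ V K hK
  have ha' (β : Fin 3) (w : TangentSpace (𝓡 m) (j q)) :=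
    sub_eq_iff_eq_add.1 ((ha _ hqU).2 Z hZ w β)
  have hb' := sub_eq_iff_eq_add.1 ((hb _ hq).2 Y hY X 0)
  set x := j q
  set w := mfderiv (𝓡 k) (𝓡 m) j q X
  have hgZ' := hgeo _ Z' hKY hZ' hZ'Y X
  have hgZ := hgeo _ Z hY hZ hZY X
  choose t ht using fun β ↦ exists_mfderiv_apply_eq_sum hJ hK β hq hqU
  rw [hb', map_add, hRq, ← hgZ, map_sum] at hgZ'
  simp only [map_smul, ht, ← hZq] at hgZ'
  rw [hRq, ← hZq] at hZ'q
  -- The three terms come from `D J`, from differentiating the coefficients `f`, and from the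
  -- derivative of `K 0` on `Q`, rewritten in the `J γ` through `t`.
  refine ⟨fun γ ↦ ∑ β, R q β * a β γ x w + mvfderiv (𝓡 m) (f γ) x w - ∑ β, b 0 β q X * t β γ, ?_⟩
  rw [← hZq, ← hZ'q, diffTensor_apply hZ', diffTensor_apply hZ, hDZ', hgZ']
  have hDW (β : Fin 3) : D (W β) x w = ∑ γ, a β γ x w • J γ x (Z x) + J β x (D Z x w) := ha' β w
  simp only [hDW, map_sub, Fin.sum_univ_three]
  module

end IsAdmissibleBasis

end QuaternionicStructures

/-! ### Vanishing of the Weyl form and the equivalence. -/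

section MainTheorem

variable {m : ℕ} {M : Type*} [TopologicalSpace M] [ChartedSpace (EuclideanSpace ℝ (Fin m)) M]
  {H : EndSubspaceField m M}

lemma tangentInvariant_id (H : EndSubspaceField m M) : TangentInvariant (k := m) H (id : M → M) := by
  intro x B _ v
  rw [mfderiv_id]
  exact ⟨B v, rfl⟩

lemma inducedEnd_id (H : EndSubspaceField m M) : inducedEnd H (id : M → M) = H := by
  ext x A
  change (∃ B ∈ H x, ∀ v, mfderiv (𝓡 m) (𝓡 m) id x (A v) = B (mfderiv (𝓡 m) (𝓡 m) id x v)) ↔ _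
  rw [mfderiv_id]
  constructor
  · rintro ⟨B, hB, h⟩
    rwa [show A = B from ContinuousLinearMap.ext h]
  · exact fun hA ↦ ⟨A, hA, fun _ ↦ rfl⟩

variable [IsManifold (𝓡 m) ∞ M] {g : RiemMetric m M}

lemma isInducedMetric_id (g : RiemMetric m M) : IsInducedMetric g (id : M → M) g := by
  intro x v w
  rw [mfderiv_id]
  rfl

lemma IsLeviCivita.isTotallyGeodesic_id {D : AffineConnection m M} (hD : IsLeviCivita g D) :
    IsTotallyGeodesic g (id : M → M) g := by
  refine ⟨D, D, hD, hD, fun q Y Z hY hZ h v ↦ ?_⟩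
  simp only [mfderiv_id] at h ⊢
  exact congrArg (fun A : TangentSpace (𝓡 m) q →L[ℝ] TangentSpace (𝓡 m) q ↦ A v)
    (D.isCovariantDerivativeOnUniv.congr_of_eventuallyEq hZ hY univ_mem h)

variable {k : ℕ} {Q : Type*} [TopologicalSpace Q] [ChartedSpace (EuclideanSpace ℝ (Fin k)) Q]
  [IsManifold (𝓡 k) ∞ Q] {j : Q → M} {gQ : RiemMetric k Q}

/-- The form of a Weyl connection parallelizing `H` vanishes along a totally geodesic,
`H`-invariant, quaternion Kähler submanifold of dimension greater than `4`. -/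
theorem weylForm_eq_zero_of_totallyGeodesic (hk : 4 < k) (hH : IsQuaternionHermitian g H)
    {D : AffineConnection m M} (hD : D.torsion = 0) (hDH : Parallelizes D g H)
    {θ : Π x : M, TangentSpace (𝓡 m) x →L[ℝ] ℝ} (hDg : CovDerivMetricEq D g θ)
    (hj : Manifold.IsImmersion (𝓡 k) (𝓡 m) ∞ j) (hinv : TangentInvariant (k := k) H j)
    (hgeo : IsTotallyGeodesic g j gQ) (hQ : IsQuaternionKahler gQ (inducedEnd H j)) (q : Q) :
    θ (j q) = 0 := by
  obtain ⟨D', DQ', hD', hDQ', hgeo⟩ := hgeo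
  obtain ⟨DQ, hDQ, hDQH⟩ := hQ.parallel
  obtain ⟨U, hqU, J, hJ⟩ := hH (j q)
  obtain ⟨V, hqV, K, hK⟩ := hQ.hermitian q
  obtain ⟨r, hr, hcomm⟩ := hJ.exists_diffTensor_comm hK hj (D' := D') hDH hDQH (q := q)
    -- The Levi-Civita connections of `gQ` supplied by the totally geodesic and the quaternion
    -- Kähler conditions agree by uniqueness.
    (fun Y Z hY hZ h v ↦ by rw [hgeo q Y Z hY hZ h v, hDQ.apply_eq hDQ' hY]) hqV hqU
  let L := (mfderiv (𝓡 k) (𝓡 m) j q).toLinearMap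
  have hL : Function.Injective L := hj.mfderiv_injective q
  have : FiniteDimensional ℝ (TangentSpace (𝓡 k) q) :=
    inferInstanceAs (FiniteDimensional ℝ (EuclideanSpace ℝ (Fin k)))
  have hrank : Module.finrank ℝ (LinearMap.range L) = k :=
    (LinearMap.finrank_range_of_inj hL).trans
      (finrank_euclideanSpace_fin (𝕜 := ℝ) (n := k))
  refine (hJ.isHermitianTriple hqU).weylForm_eq_zero (fun Y X ↦ diffTensor D D' (j q) Y X) (θ (j q))
    (two_mul_inner_diffTensor hD hDg hD') (LinearMap.range L) (by omega) ?_ r ?_ ?_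
  · rintro α _ ⟨v, rfl⟩
    obtain ⟨w, hw⟩ := hinv q _ (hJ.mem hqU α) v
    exact ⟨w, hw.symm⟩
  · rintro _ ⟨v, rfl⟩
    change ∑ α, r α • J α (j q) (∑ β, r β • J β (j q) (mfderiv (𝓡 k) (𝓡 m) j q v)) =
      -mfderiv (𝓡 k) (𝓡 m) j q v
    rw [← hr, ← hr, hK.sq 0 q hqV, map_neg]
  · rintro _ ⟨X, rfl⟩ _ ⟨Y, rfl⟩ hY
    exact hcomm X Y fun h ↦ hY (by rw [h, map_zero])

end MainTheorem

theorem mainTheorem12 (n : ℕ) (hn : 2 ≤ n) (M : Type u) [TopologicalSpace M] [T2Space M]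
    [ParacompactSpace M] [ChartedSpace (EuclideanSpace ℝ (Fin (4 * n))) M]
    [IsManifold (𝓡 (4 * n)) ∞ M] (g : RiemMetric (4 * n) M) (H : EndSubspaceField (4 * n) M)
    (hW : IsQuaternionHermitianWeyl g H) :
    IsQuaternionKahler g H ↔
      ∀ x : M, ∃ (h : ℕ) (_ : 2 ≤ h) (Q : Type u) (_ : TopologicalSpace Q) (_ : T2Space Q)
        (_ : ParacompactSpace Q) (_ : ChartedSpace (EuclideanSpace ℝ (Fin (4 * h))) Q)
        (_ : IsManifold (𝓡 (4 * h)) ∞ Q) (j : Q → M) (gQ : RiemMetric (4 * h) Q),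
        Manifold.IsImmersion (𝓡 (4 * h)) (𝓡 (4 * n)) ∞ j ∧ Function.Injective j ∧
        x ∈ Set.range j ∧
        IsInducedMetric (k := 4 * h) g j gQ ∧
        TangentInvariant (k := 4 * h) H j ∧
        IsTotallyGeodesic (k := 4 * h) g j gQ ∧
        IsQuaternionKahler gQ (inducedEnd (k := 4 * h) H j) := by
  constructor
  · intro hK x
    obtain ⟨D, hD, -⟩ := hK.parallel
    exact ⟨n, hn, M, _, inferInstance, inferInstance, _, inferInstance, id, g,
      Manifold.IsImmersion.id, Function.injective_id, ⟨x, rfl⟩, isInducedMetric_id g,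
      tangentInvariant_id H, hD.isTotallyGeodesic_id, by rwa [inducedEnd_id]⟩
  · intro hsub
    have hH := hW.hermitian g (IsConformal.refl g)
    obtain ⟨D, hD, hDH⟩ := hW.weyl
    obtain ⟨θ, -, hθ⟩ := hD.preserves g (IsConformal.refl g)
    have hθ0 : θ = fun _ ↦ 0 := by
      funext x
      obtain ⟨h, hh, Q, _, _, _, _, _, j, gQ, hj, -, ⟨q, rfl⟩, -, hinv, hgeo, hQ⟩ := hsub x
      exact weylForm_eq_zero_of_totallyGeodesic (by omega) hH hD.torsion_free hDH hθ hj hinv hgeo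
        hQ q
    -- With `θ = 0` the Weyl connection `D` is itself Levi-Civita for `g`.
    exact ⟨hH, D, ⟨hD.torsion_free, hθ0 ▸ hθ⟩, hDH⟩
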